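/- Let $\Pi\subset\mathbb R^d$ be a polyhedron defined by finitely many affine inequalities with rational coefficients. Assume that $\Pi$ has a vertex and that its recession cone $C$ has dimension $d$, and put $\Lambda=\Pi\cap\mathbb Z^d$. For an extremal ray $\rho$ of $C$, let $T_\rho C=\bigcap_{H\supset\rho}H_+$, where $H$ runs over the supporting hyperplanes of $C$ containing $\rho$ and $H_+\supseteq C$ is the closed halfspace bounded by $H$. Let $\Gamma\subset\mathbb Z^d\setminus\{\mathbf 0\}$ be a rule set, i.e. a finite set such that (1) some linear function on $\mathbb R^d$ is positive on $C\setminus\{\mathbf 0\}$ and on $\Gamma$, and (2) for each extremal ray $\rho$ of $C$, some $\gamma_\rho\in\Gamma$ lies in $-T_\rho C$. Let $\mathcal D\subseteq\Lambda$ be a finite $\Gamma$-order ideal, i.e. a finite set such that $p\in\mathcal D$ whenever $p\in\Lambda$, $q\in\mathcal D$ and $q-p$ lies in the monoid $\mathbb N\Gamma$ generated by $\Gamma$. Let $\mathcal B=\Lambda\setminus\mathcal D$ be the game board. From $p$ there is a legal move to $q$ if $p-q\in\Gamma$ and $q\in\mathcal B$. Then there is a finite set $F\subset\mathcal B$ such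 that every $p\in\mathcal B$ has a $\Gamma$-path in $\mathcal B$ to $F$, i.e. a sequence $p=p_0,p_1,\dots,p_r$ ($r\ge 0$) of elements of $\mathcal B$ with $p_{k-1}-p_k\in\Gamma$ for $1\le k\le r$ and $p_r\in F$. Equivalently, the set of victorious positions (the positions in $\mathcal B$ from which there is no legal move) is finite; so this set is finite as well. -/

import Mathlib

/-- The real point underlying an integer point. -/
def LatticeGame.toReal {d : ℕ} (p : Fin d → ℤ) : Fin d → ℝ := fun i => (p i : ℝ)

/-- A rational polyhedron in `ℝ^d`: the solution set of finitely many (weak) affine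
inequalities with rational coefficients. -/
def LatticeGame.IsRationalPolyhedron {d : ℕ} (P : Set (Fin d → ℝ)) : Prop :=
  ∃ (m : ℕ) (A : Matrix (Fin m) (Fin d) ℚ) (b : Fin m → ℚ),
    P = {x | ∀ i, (b i : ℝ) ≤ ∑ j, (A i j : ℝ) * x j}

/-- The recession cone of `P`: the directions `v` in which one can go arbitrarily far from
every point of `P` without leaving `P`. -/
def LatticeGame.recessionCone {d : ℕ} (P : Set (Fin d → ℝ)) : Set (Fin d → ℝ) :=
  {v | ∀ x ∈ P, ∀ t : ℝ, 0 ≤ t → x + t • v ∈ P}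

/-- `ρ` is an extremal ray of the cone `C`: a half-line from the origin, contained in `C`, that
is an extreme subset (a one-dimensional face) of `C`. -/
def LatticeGame.IsExtremalRay {d : ℕ} (C ρ : Set (Fin d → ℝ)) : Prop :=
  (∃ v : Fin d → ℝ, v ≠ 0 ∧ ρ = {x | ∃ t : ℝ, 0 ≤ t ∧ x = t • v}) ∧ IsExtreme ℝ C ρ

/-- The tangent cone of `C` along `ρ`: the intersection of the closed halfspaces `{f ≥ 0}`
containing `C` whose bounding hyperplane `{f = 0}` contains `ρ`. (A hyperplane that contains
a ray from the origin passes through the origin, so it is the kernel of a linear form.) -/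
def LatticeGame.rayTangentCone {d : ℕ} (C ρ : Set (Fin d → ℝ)) : Set (Fin d → ℝ) :=
  {x | ∀ f : (Fin d → ℝ) →ₗ[ℝ] ℝ, f ≠ 0 → (∀ y ∈ C, 0 ≤ f y) → (∀ y ∈ ρ, f y = 0) → 0 ≤ f x}

/-- The negative tangent cone of `C` along `ρ`. -/
def LatticeGame.negTangentCone {d : ℕ} (C ρ : Set (Fin d → ℝ)) : Set (Fin d → ℝ) :=
  {x | -x ∈ LatticeGame.rayTangentCone C ρ}

/-- A finite set `Γ` of nonzero integer vectors is a rule set for the cone `C` if it satisfies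
the positivity axiom and the tangent cone axiom. -/
structure LatticeGame.IsRuleSet {d : ℕ} (C : Set (Fin d → ℝ)) (Γ : Finset (Fin d → ℤ)) :
    Prop where
  zero_notMem : (0 : Fin d → ℤ) ∉ Γ
  positivity : ∃ l : (Fin d → ℝ) →ₗ[ℝ] ℝ,
    (∀ x ∈ C, x ≠ 0 → 0 < l x) ∧ ∀ γ ∈ Γ, 0 < l (LatticeGame.toReal γ)
  tangent : ∀ ρ : Set (Fin d → ℝ), LatticeGame.IsExtremalRay C ρ →
    ∃ γ ∈ Γ, LatticeGame.toReal γ ∈ LatticeGame.negTangentCone C ρ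

/-- The integer points of `P`. -/
def LatticeGame.latticePoints {d : ℕ} (P : Set (Fin d → ℝ)) : Set (Fin d → ℤ) :=
  {p | LatticeGame.toReal p ∈ P}

/-- `D` is a `Γ`-order ideal in `L`: a subset of `L` closed downward in `L` for the relation
`p ≼ q ↔ q - p ∈ ℕΓ`. -/
def LatticeGame.IsOrderIdeal {d : ℕ} (Γ : Finset (Fin d → ℤ)) (L D : Set (Fin d → ℤ)) : Prop :=
  D ⊆ L ∧ ∀ p ∈ L, ∀ q ∈ D, q - p ∈ AddSubmonoid.closure (Γ : Set (Fin d → ℤ)) → p ∈ D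

/-- A lattice game in dimension `d`. -/
structure LatticeGame (d : ℕ) where
  /-- the polyhedron -/
  polyhedron : Set (Fin d → ℝ)
  rational : LatticeGame.IsRationalPolyhedron polyhedron
  /-- the polyhedron is pointed, that is, it has a vertex -/
  pointed : (polyhedron.extremePoints ℝ).Nonempty
  /-- the recession cone has dimension `d` -/
  full_dim : Module.finrank ℝ
    (Submodule.span ℝ (LatticeGame.recessionCone polyhedron)) = d
  /-- the rule set -/
  rules : Finset (Fin d → ℤ)
  isRuleSet : LatticeGame.IsRuleSet (LatticeGame.recessionCone polyhedron) rules
  /-- the defeated positions -/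
  defeated : Set (Fin d → ℤ)
  defeated_finite : defeated.Finite
  defeated_ideal :
    LatticeGame.IsOrderIdeal rules (LatticeGame.latticePoints polyhedron) defeated

/-- The game board: the lattice points of the polyhedron that are not defeated positions. -/
def LatticeGame.board {d : ℕ} (G : LatticeGame d) : Set (Fin d → ℤ) :=
  LatticeGame.latticePoints G.polyhedron \ G.defeated

/-- There is a legal move from `p` to `q`. -/
def LatticeGame.LegalMove {d : ℕ} (G : LatticeGame d) (p q : Fin d → ℤ) : Prop :=
  p - q ∈ G.rules ∧ q ∈ G.board

/-- The victorious positions: the positions on the board from which there is no legal move. -/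
def LatticeGame.victorious {d : ℕ} (G : LatticeGame d) : Set (Fin d → ℤ) :=
  {p | p ∈ G.board ∧ ∀ q, ¬ G.LegalMove p q}

/-- There is a `Γ`-path `s 0, …, s r` from `p` to `q` in `S`. -/
def LatticeGame.HasPath {d : ℕ} (Γ : Finset (Fin d → ℤ)) (S : Set (Fin d → ℤ))
    (p q : Fin d → ℤ) : Prop :=
  ∃ (r : ℕ) (s : ℕ → Fin d → ℤ), s 0 = p ∧ s r = q ∧
    (∀ k < r, s k - s (k + 1) ∈ Γ) ∧ ∀ k ≤ r, s k ∈ S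

/-! The victorious positions themselves serve as the finite set `F`.

Let `Π = {x | ∀ i, b i ≤ a i x}`. An infinite set of lattice points of `Π` escapes to infinity in
some direction: along a suitable ultrafilter the unit vectors `p / ‖p‖` converge to some `v ≠ 0`,
and every linear form that is positive at `v` tends to `+∞` (`exists_asymptotic_direction`). In
particular `v` lies in the recession cone `C`. The Krein–Milman theorem, applied to the slice
`l = 1` of the smallest face of `C` containing `v`, gives an extremal ray `ρ` in that face
(`exists_isExtremalRay_of_mem`). Let `γ` be a rule in `-T_ρ C`. If `a i γ > 0`, then `a i` does not
vanish on `ρ`, hence `a i v > 0`, and so `a i` tends to `+∞`; the other forms do not decrease under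
the move `p ↦ p - γ`. So for `p` far out this move stays in `Π`, and it avoids the finite set of
defeated positions (`exists_legalMove_of_infinite`). Hence only finitely many positions admit no
move.

Since `l > 0` on `C \ {0}`, the sublevel sets of `l` on the board are finite, again by
`exists_asymptotic_direction`. Each move decreases `l`, so every play ends, and it ends in a
victorious position. -/

namespace LatticeGame

open Filter Topology

variable {d : ℕ}

/-! ### Asymptotic directions of sets of lattice points -/

theorem toReal_sub (p q : Fin d → ℤ) : toReal (p - q) = toReal p - toReal q := by
  ext i; simp [toReal]

theorem norm_toReal (p : Fin d → ℤ) : ‖toReal p‖ = ‖p‖ :=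
  rfl

theorem tendsto_norm_toReal_cofinite :
    Tendsto (fun p : Fin d → ℤ => ‖toReal p‖) cofinite atTop := by
  simp only [norm_toReal]
  rw [← cocompact_eq_cofinite]
  exact tendsto_norm_cocompact_atTop

/-- An infinite set of lattice points accumulates at infinity in some direction `v`. The filter
`L` plays the role of a sequence of distinct points of `S` going to infinity. -/
theorem exists_asymptotic_direction {S : Set (Fin d → ℤ)} (hS : S.Infinite) :
    ∃ (L : Filter (Fin d → ℤ)) (v : Fin d → ℝ), L.NeBot ∧ L ≤ cofinite ∧ S ∈ L ∧ v ≠ 0 ∧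
      ∀ g : (Fin d → ℝ) →ₗ[ℝ] ℝ, 0 < g v → Tendsto (fun p => g (toReal p)) L atTop := by
  have : NeBot (cofinite ⊓ 𝓟 S) := hS.cofinite_inf_principal_neBot
  let U : Ultrafilter (Fin d → ℤ) := Ultrafilter.of (cofinite ⊓ 𝓟 S)
  have hU : (U : Filter (Fin d → ℤ)) ≤ cofinite ⊓ 𝓟 S := Ultrafilter.of_le _
  have hcof : (U : Filter (Fin d → ℤ)) ≤ cofinite := hU.trans inf_le_left
  have hnorm := tendsto_norm_toReal_cofinite (d := d) |>.mono_left hcof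
  let u : (Fin d → ℤ) → Fin d → ℝ := fun p => ‖toReal p‖⁻¹ • toReal p
  have hsphere : ∀ᶠ p in (U : Filter (Fin d → ℤ)), u p ∈ Metric.sphere (0 : Fin d → ℝ) 1 := by
    filter_upwards [hnorm.eventually_gt_atTop 0] with p hp
    simp [u, norm_smul, hp.ne']
  obtain ⟨v, hv, hlim⟩ := isCompact_iff_ultrafilter_le_nhds.1
    (isCompact_sphere (0 : Fin d → ℝ) 1) (U.map u) (le_principal_iff.2 hsphere)
  refine ⟨U, v, inferInstance, hcof, le_principal_iff.1 (hU.trans inf_le_right), ?_, ?_⟩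
  · rintro rfl
    simp at hv
  · intro g hg
    have hgu : Tendsto (fun p => g (u p)) U (𝓝 (g v)) :=
      (g.continuous_of_finiteDimensional.tendsto v).comp hlim
    refine (hnorm.atTop_mul_pos hg hgu).congr' ?_
    filter_upwards [hnorm.eventually_gt_atTop 0] with p hp
    simp only [u, map_smul, smul_eq_mul]
    field_simp

theorem nonneg_of_asymptotic_direction {L : Filter (Fin d → ℤ)} [L.NeBot] {v : Fin d → ℝ}
    (hL : ∀ g : (Fin d → ℝ) →ₗ[ℝ] ℝ, 0 < g v → Tendsto (fun p => g (toReal p)) L atTop)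
    {f : (Fin d → ℝ) →ₗ[ℝ] ℝ} {c : ℝ} (hf : ∀ᶠ p in L, c ≤ f (toReal p)) : 0 ≤ f v := by
  by_contra! h
  have hlim := hL (-f) (by simpa using h)
  obtain ⟨p, hp, hp'⟩ := (hf.and (hlim.eventually_gt_atTop (-c))).exists
  simp only [LinearMap.neg_apply] at hp'
  linarith

/-! ### Polyhedral cones and their extremal rays -/

theorem recessionCone_eq {ι : Type*} {a : ι → (Fin d → ℝ) →ₗ[ℝ] ℝ} {b : ι → ℝ}
    (hne : {x | ∀ i, b i ≤ a i x}.Nonempty) :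
    recessionCone {x | ∀ i, b i ≤ a i x} = {v | ∀ i, 0 ≤ a i v} := by
  ext v
  refine ⟨fun hv i => ?_, fun hv x hx t ht i => ?_⟩
  · obtain ⟨x, hx⟩ := hne
    by_contra! h
    -- At this parameter `a i (x + t • v)` equals `b i - 1`.
    let t := (a i x - b i + 1) / (-a i v)
    have hxi := hx i
    have ht : 0 ≤ t := div_nonneg (by linarith) (by linarith)
    have key := hv x hx t ht i
    have htv : t * (-a i v) = a i x - b i + 1 := div_mul_cancel₀ _ (by linarith)
    simp only [map_add, map_smul, smul_eq_mul] at key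
    linarith
  · have := mul_nonneg ht (hv i)
    have := hx i
    simp only [map_add, map_smul, smul_eq_mul]
    linarith

/-- The slice `l = 1` of a closed cone on which `l` is positive is bounded. -/
theorem isBounded_slice {E : Type*} [NormedAddCommGroup E] [NormedSpace ℝ E]
    [FiniteDimensional ℝ E] {C : Set E} (hC : IsClosed C)
    (hsmul : ∀ x ∈ C, ∀ t : ℝ, 0 ≤ t → t • x ∈ C) {l : E →ₗ[ℝ] ℝ}
    (hl : ∀ x ∈ C, x ≠ 0 → 0 < l x) : Bornology.IsBounded {x ∈ C | l x = 1} := by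
  have hcomp : IsCompact (Metric.sphere (0 : E) 1 ∩ C) := by
    have := FiniteDimensional.proper ℝ E
    exact (isCompact_sphere _ _).inter_right hC
  have hunit : ∀ x ∈ C, x ≠ 0 → ‖x‖⁻¹ • x ∈ Metric.sphere (0 : E) 1 ∩ C := fun x hx h0 =>
    ⟨by simp [norm_smul, h0], hsmul x hx _ (by positivity)⟩
  rcases (Metric.sphere (0 : E) 1 ∩ C).eq_empty_or_nonempty with hemp | hne
  · refine Set.Finite.isBounded ((Set.finite_singleton 0).subset fun x hx => ?_)
    by_contra h0
    simpa [hemp] using hunit x hx.1 h0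
  · obtain ⟨u, hu, hmin⟩ := hcomp.exists_isMinOn hne l.continuous_of_finiteDimensional.continuousOn
    have hpos : 0 < l u := hl u hu.2 (by rintro rfl; simpa using hu.1)
    refine isBounded_iff_forall_norm_le.2 ⟨(l u)⁻¹, fun x hx => ?_⟩
    have hx0 : x ≠ 0 := by
      rintro rfl
      simpa using hx.2
    have h := hmin (hunit x hx.1 hx0)
    simp only [Set.mem_ofPred_eq, map_smul, smul_eq_mul, hx.2, mul_one] at h
    rwa [le_inv_comm₀ (norm_pos_iff.2 hx0) hpos]

/-- The smallest face of a pointed polyhedral cone containing a given nonzero vector `v` contains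
an extremal ray. (That face is cut out by the forms `a i` vanishing at `v`.) -/
theorem exists_isExtremalRay_of_mem {ι : Type*} {a : ι → (Fin d → ℝ) →ₗ[ℝ] ℝ}
    {l : (Fin d → ℝ) →ₗ[ℝ] ℝ} (hl : ∀ x ∈ {x | ∀ i, 0 ≤ a i x}, x ≠ 0 → 0 < l x)
    {v : Fin d → ℝ} (hv : v ∈ {x | ∀ i, 0 ≤ a i x}) (hv0 : v ≠ 0) :
    ∃ w : Fin d → ℝ, (∀ i, a i v = 0 → a i w = 0) ∧
      IsExtremalRay {x | ∀ i, 0 ≤ a i x} {x | ∃ t : ℝ, 0 ≤ t ∧ x = t • w} := by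
  set C : Set (Fin d → ℝ) := {x | ∀ i, 0 ≤ a i x} with hCdef
  have hsmul : ∀ x ∈ C, ∀ t : ℝ, 0 ≤ t → t • x ∈ C := fun x hx t ht i => by
    simpa using mul_nonneg ht (hx i)
  have hcont : ∀ g : (Fin d → ℝ) →ₗ[ℝ] ℝ, Continuous g :=
    fun g => g.continuous_of_finiteDimensional
  have hCclosed : IsClosed C := by
    simp only [hCdef, Set.ofPred_forall]
    exact isClosed_iInter fun i => isClosed_le continuous_const (hcont _)
  let F : Set (Fin d → ℝ) := {x | ∀ i, a i v = 0 → a i x = 0}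
  have hFclosed : IsClosed F := by
    simp only [F, Set.ofPred_forall]
    exact isClosed_iInter fun i => isClosed_iInter fun _ =>
      isClosed_eq (hcont _) continuous_const
  let K : Set (Fin d → ℝ) := F ∩ {x ∈ C | l x = 1}
  have hK : IsCompact K := Metric.isCompact_of_isClosed_isBounded
    (hFclosed.inter (hCclosed.inter (isClosed_eq (hcont _) continuous_const)))
    ((isBounded_slice hCclosed hsmul hl).subset Set.inter_subset_right)
  have hnormalize : ∀ x ∈ C, x ∈ F → x ≠ 0 → (l x)⁻¹ • x ∈ K := fun x hx hxF hx0 =>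
    ⟨fun i hi => by simp [hxF i hi], hsmul x hx _ (inv_nonneg.2 (hl x hx hx0).le),
      by simp [(hl x hx hx0).ne']⟩
  obtain ⟨w, hw⟩ := hK.extremePoints_nonempty ⟨_, hnormalize v hv (fun _ hi => hi) hv0⟩
  have hwK : w ∈ K := hw.1
  have hw0 : w ≠ 0 := by
    rintro rfl
    simpa using hwK.2.2
  refine ⟨w, hwK.1, ⟨w, hw0, rfl⟩, ⟨?_, ?_⟩⟩
  · rintro _ ⟨t, ht, rfl⟩
    exact hsmul w hwK.2.1 t ht
  · rintro x hx y hy _ ⟨t, ht, rfl⟩ ⟨α, β, hα, hβ, -, hxy⟩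
    have hsum : ∀ g : (Fin d → ℝ) →ₗ[ℝ] ℝ, α * g x + β * g y = t * g w := fun g => by
      simpa using congrArg g hxy
    have hxF : x ∈ F := fun i hi => by
      have h := hsum (a i)
      rw [hwK.1 i hi, mul_zero] at h
      nlinarith [hx i, hy i, mul_nonneg hβ.le (hy i), mul_nonneg hα.le (hx i)]
    have hyF : y ∈ F := fun i hi => by
      have h := hsum (a i)
      rw [hwK.1 i hi, mul_zero] at h
      nlinarith [hx i, hy i, mul_nonneg hβ.le (hy i), mul_nonneg hα.le (hx i)]
    by_cases hx0 : x = 0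
    · exact ⟨0, le_rfl, by simp [hx0]⟩
    by_cases hy0 : y = 0
    · refine ⟨α⁻¹ * t, by positivity, ?_⟩
      rw [mul_smul, ← hxy, hy0, smul_zero, add_zero, smul_smul, inv_mul_cancel₀ hα.ne', one_smul]
    have hlx := hl x hx hx0
    have hly := hl y hy hy0
    have hlt : α * l x + β * l y = t := by simpa [hwK.2.2] using hsum l
    have htpos : 0 < t := hlt ▸ by positivity
    -- `w` is a proper convex combination of the normalizations of `x` and `y`.
    have hseg : w ∈ openSegment ℝ ((l x)⁻¹ • x) ((l y)⁻¹ • y) := by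
      refine ⟨t⁻¹ * (α * l x), t⁻¹ * (β * l y), by positivity, by positivity, ?_, ?_⟩
      · rw [← mul_add, hlt, inv_mul_cancel₀ htpos.ne']
      · rw [smul_smul, smul_smul, mul_assoc, mul_assoc, mul_assoc, mul_assoc,
          mul_inv_cancel₀ hlx.ne', mul_inv_cancel₀ hly.ne', mul_one, mul_one, mul_smul, mul_smul,
          ← smul_add, hxy, smul_smul, inv_mul_cancel₀ htpos.ne', one_smul]
    have hxw := hw.2 (hnormalize x hx hxF hx0) (hnormalize y hy hyF hy0) hseg
    exact ⟨l x, hlx.le, by rw [← hxw, smul_smul, mul_inv_cancel₀ hlx.ne', one_smul]⟩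

/-! ### Legal moves -/

theorem IsRationalPolyhedron.exists_linearMap {P : Set (Fin d → ℝ)}
    (hP : IsRationalPolyhedron P) :
    ∃ (m : ℕ) (a : Fin m → (Fin d → ℝ) →ₗ[ℝ] ℝ) (b : Fin m → ℝ),
      P = {x | ∀ i, b i ≤ a i x} := by
  obtain ⟨m, A, b, rfl⟩ := hP
  refine ⟨m, fun i => ∑ j, (A i j : ℝ) • LinearMap.proj j, fun i => b i, ?_⟩
  simp [LinearMap.sum_apply]

/-- An asymptotic direction of lattice points of a polyhedron lies in its recession cone. -/
theorem exists_asymptotic_direction_mem_recessionCone {m : ℕ}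
    {a : Fin m → (Fin d → ℝ) →ₗ[ℝ] ℝ} {b : Fin m → ℝ}
    {S : Set (Fin d → ℤ)} (hS : S.Infinite) (hSP : S ⊆ latticePoints {x | ∀ i, b i ≤ a i x}) :
    ∃ (L : Filter (Fin d → ℤ)) (v : Fin d → ℝ), L.NeBot ∧ L ≤ cofinite ∧ S ∈ L ∧ v ≠ 0 ∧
      (∀ i, 0 ≤ a i v) ∧
      ∀ g : (Fin d → ℝ) →ₗ[ℝ] ℝ, 0 < g v → Tendsto (fun p => g (toReal p)) L atTop := by
  obtain ⟨L, v, hne, hcof, hSL, hv0, hL⟩ := exists_asymptotic_direction hS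
  refine ⟨L, v, hne, hcof, hSL, hv0, fun i => ?_, hL⟩
  exact nonneg_of_asymptotic_direction hL (mem_of_superset hSL fun p hp => hSP hp i)

/-- Every infinite set of positions contains one from which there is a legal move. -/
theorem exists_legalMove_of_infinite (G : LatticeGame d) {S : Set (Fin d → ℤ)}
    (hS : S.Infinite) (hSB : S ⊆ G.board) : ∃ p ∈ S, ∃ q, G.LegalMove p q := by
  obtain ⟨m, a, b, hP⟩ := G.rational.exists_linearMap
  have hCone : recessionCone G.polyhedron = {x | ∀ i, 0 ≤ a i x} := by
    rw [hP]
    exact recessionCone_eq (hP ▸ G.pointed.mono extremePoints_subset)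
  obtain ⟨l, hl, -⟩ := G.isRuleSet.positivity
  have hSP : S ⊆ latticePoints {x | ∀ i, b i ≤ a i x} := fun p hp => hP ▸ (hSB hp).1
  obtain ⟨L, v, hne, hcof, hSL, hv0, hvC, hL⟩ :=
    exists_asymptotic_direction_mem_recessionCone hS hSP
  rw [hCone] at hl
  obtain ⟨w, hw, hray⟩ := exists_isExtremalRay_of_mem hl hvC hv0
  rw [← hCone] at hray
  obtain ⟨γ, hγ, hγT⟩ := G.isRuleSet.tangent _ hray
  -- A form that is decreased by the move `γ` cannot vanish on the extremal ray, hence not at `v`.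
  have hpos : ∀ i, 0 < a i (toReal γ) → 0 < a i v := fun i hi => by
    refine (hvC i).lt_of_ne fun h0 => ?_
    have hneg := hγT (a i) (by intro h; simp [h] at hi) (fun y hy => (hCone ▸ hy :) i)
      (by rintro _ ⟨t, -, rfl⟩; simp [hw i h0.symm])
    rw [map_neg] at hneg
    linarith
  have hpoly : ∀ᶠ p in L, ∀ i, b i ≤ a i (toReal (p - γ)) := by
    refine eventually_all.2 fun i => ?_
    simp only [toReal_sub, map_sub]
    rcases le_or_gt (a i (toReal γ)) 0 with hi | hi
    · filter_upwards [hSL] with p hp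
      have : b i ≤ a i (toReal p) := hSP hp i
      linarith
    · filter_upwards [(hL _ (hpos i hi)).eventually_ge_atTop (b i + a i (toReal γ))] with p hp
      linarith
  have hdef : ∀ᶠ p in L, p - γ ∉ G.defeated :=
    hcof ((G.defeated_finite.preimage (sub_left_injective.injOn)).compl_mem_cofinite)
  obtain ⟨p, hp, hpP, hpD⟩ := ((show ∀ᶠ p in L, p ∈ S from hSL).and (hpoly.and hdef)).exists
  refine ⟨p, hp, p - γ, by simpa using hγ, ?_, hpD⟩
  change toReal (p - γ) ∈ G.polyhedron
  rw [hP]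
  exact hpP

theorem victorious_finite (G : LatticeGame d) : G.victorious.Finite := by
  by_contra h
  obtain ⟨p, hp, q, hq⟩ := exists_legalMove_of_infinite G h fun _ hp => hp.1
  exact hp.2 q hq

/-- A linear form positive on the nonzero recession directions has finite sublevel sets on the
board. -/
theorem finite_board_sublevel (G : LatticeGame d) {l : (Fin d → ℝ) →ₗ[ℝ] ℝ}
    (hl : ∀ x ∈ recessionCone G.polyhedron, x ≠ 0 → 0 < l x) (c : ℝ) :
    {p ∈ G.board | l (toReal p) ≤ c}.Finite := by
  by_contra h
  obtain ⟨m, a, b, hP⟩ := G.rational.exists_linearMap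
  have hne := G.pointed.mono extremePoints_subset
  rw [hP] at hne hl
  obtain ⟨L, v, _, -, hSL, hv0, hvC, hL⟩ :=
    exists_asymptotic_direction_mem_recessionCone (a := a) (b := b) h
      fun p hp => hP ▸ hp.1.1
  rw [recessionCone_eq hne] at hl
  obtain ⟨p, hp, hp'⟩ := (((hL l (hl v hvC hv0)).eventually_gt_atTop c).and hSL).exists
  exact absurd hp'.2 hp.not_ge

/-! ### Paths -/

theorem HasPath.refl {Γ : Finset (Fin d → ℤ)} {S : Set (Fin d → ℤ)} {p : Fin d → ℤ}
    (hp : p ∈ S) : HasPath Γ S p p :=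
  ⟨0, fun _ => p, rfl, rfl, by simp, fun _ _ => hp⟩

theorem HasPath.cons {Γ : Finset (Fin d → ℤ)} {S : Set (Fin d → ℤ)} {p q r : Fin d → ℤ}
    (hp : p ∈ S) (hpq : p - q ∈ Γ) (h : HasPath Γ S q r) : HasPath Γ S p r := by
  obtain ⟨n, s, h0, hn, hstep, hmem⟩ := h
  refine ⟨n + 1, fun k => Nat.casesOn k p s, rfl, hn, ?_, ?_⟩
  · rintro (_ | k) hk
    · simpa [h0] using hpq
    · exact hstep k (by omega)
  · rintro (_ | k) hk
    · exact hp
    · exact hmem k (by omega)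

theorem exists_hasPath_victorious (G : LatticeGame d) (p : Fin d → ℤ) (hp : p ∈ G.board) :
    ∃ q ∈ G.victorious, HasPath G.rules G.board p q := by
  obtain ⟨l, hl, hlΓ⟩ := G.isRuleSet.positivity
  have hfin := finite_board_sublevel G hl
  -- The number of positions whose `l`-value is at most that of `p` drops with every move.
  induction hn : {q ∈ G.board | l (toReal q) ≤ l (toReal p)}.ncard using Nat.strong_induction_on
    generalizing p with
  | _ n ih =>
    by_cases hv : p ∈ G.victorious
    · exact ⟨p, hv, HasPath.refl hp⟩
    obtain ⟨q, hq⟩ : ∃ q, G.LegalMove p q := by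
      by_contra! h
      exact hv ⟨hp, h⟩
    have hlt : l (toReal q) < l (toReal p) := by
      have := hlΓ _ hq.1
      rw [toReal_sub, map_sub] at this
      linarith
    have hcard : {x ∈ G.board | l (toReal x) ≤ l (toReal q)}.ncard < n := by
      rw [← hn]
      refine Set.ncard_lt_ncard ⟨fun x hx => ⟨hx.1, hx.2.trans hlt.le⟩, fun h => ?_⟩ (hfin _)
      exact absurd (h ⟨hp, le_rfl⟩).2 hlt.not_ge
    obtain ⟨r, hr, hpath⟩ := ih _ hcard q hq.2 rfl
    exact ⟨r, hr, hpath.cons hp hq.1⟩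

end LatticeGame

theorem theorem3 {d : ℕ} (G : LatticeGame d) :
    (∃ F : Set (Fin d → ℤ), F.Finite ∧ F ⊆ G.board ∧
      ∀ p ∈ G.board, ∃ q ∈ F, LatticeGame.HasPath G.rules G.board p q) ∧
    G.victorious.Finite :=
  ⟨⟨G.victorious, G.victorious_finite, fun _ hp => hp.1, G.exists_hasPath_victorious⟩,
    G.victorious_finite⟩
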